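/- Let $K$ be a field, let $S=K[t_1,\ldots,t_s]$, and let $z=t_{s+1}$ be a new variable. Let $I$ be an ideal of $S$ generated by monomials of degree $2$ (squares $t_i^2$ are allowed), let $t^{v_1},\ldots,t^{v_q}$ be its (distinct) minimal monomial generators, and let $A$ be the incidence matrix of $I$, that is, the $s\times q$ matrix with columns $v_1,\ldots,v_q\in\mathbb{N}^s$. Put $$\mathcal{B}=\{e_{s+1}\}\cup\{e_i+e_{s+1}\}_{i=1}^s\cup\{(v_j,1)\}_{j=1}^q\subset\mathbb{N}^{s+1},\qquad \mathcal{Q}=\mathrm{conv}(0,e_1,\ldots,e_s,v_1,\ldots,v_q)\subset\mathbb{R}^s,$$ and let $K[\mathbb{N}\mathcal{B}]=K[z,t_1z,\ldots,t_sz,t^{v_1}z,\ldots,t^{v_q}z]\subset S[z]$ be the semigroup ring of $\mathbb{N}\mathcal{B}$ and $\mathrm{Er}(\mathcal{Q})=K[t^\alpha z^b\mid b\in\mathbb{N},\ \alpha\in\mathbb{Z}^s\cap b\mathcal{Q}]\subset S[z]$ the Ehrhart ring of $\mathcal{Q}$. Then: (1) the normalization of $K[\mathbb{N}\mathcal{B}]$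 (the set of all elements of its field of fractions that are integral over it, taken inside the field of fractions of $S[z]$) is equal to $\mathrm{Er}(\mathcal{Q})$; (2) $K[\mathbb{N}\mathcal{B}]=\mathrm{Er}(\mathcal{Q})$ if and only if the linear system $x\geq 0;\ xA\leq 1$ has the integer rounding property, that is, $$\lceil\min\{\langle y,1\rangle\mid y\in\mathbb{R}^q,\ y\geq 0,\ Ay\geq\alpha\}\rceil=\min\{\langle y,1\rangle\mid y\in\mathbb{N}^q,\ Ay\geq\alpha\}$$ for each $\alpha\in\mathbb{Z}^s$ for which the left-hand side is finite (that is, for which the minimum on the left-hand side exists). -/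

import Mathlib

open scoped Pointwise

noncomputable section

/-- The exponents of the minimal monomial generators of a monomial ideal `I` of `K[t_1,…,t_s]`:
the vectors `v` with `t^v ∈ I` that are minimal for divisibility (the componentwise order). -/
def minGenExponents {K : Type*} [Field K] {s : ℕ} (I : Ideal (MvPolynomial (Fin s) K)) :
    Set (Fin s →₀ ℕ) :=
  {v | Minimal (fun a : Fin s →₀ ℕ => MvPolynomial.monomial a (1 : K) ∈ I) v}

/-- `I` is generated by (some set of) monomials of degree `2`. Squares `t_i^2` are allowed. -/
def IsGeneratedByQuadraticMonomials {K : Type*} [Field K] {s : ℕ}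
    (I : Ideal (MvPolynomial (Fin s) K)) : Prop :=
  ∃ F : Set (Fin s →₀ ℕ), (∀ a ∈ F, a.degree = 2) ∧
    I = Ideal.span ((fun a => MvPolynomial.monomial a (1 : K)) '' F)

/-- The `s × q` matrix with columns `v_1,…,v_q`. -/
def incidenceMatrix {s q : ℕ} (v : Fin q → (Fin s →₀ ℕ)) : Matrix (Fin s) (Fin q) ℕ :=
  Matrix.of fun i j => v j i

/-- The exponent vector `(a, b)` of the monomial `t^a z^b` of `S[z] = K[t_1,…,t_s,z]`, where
`z = t_{s+1}` is the last variable. -/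
def withZ {s : ℕ} (a : Fin s →₀ ℕ) (b : ℕ) : Fin (s + 1) →₀ ℕ :=
  a.mapDomain Fin.castSucc + Finsupp.single (Fin.last s) b

/-- The set `B = {e_{s+1}} ∪ {e_i + e_{s+1}} ∪ {(v_j, 1)}`. -/
def setB {s q : ℕ} (v : Fin q → (Fin s →₀ ℕ)) : Set (Fin (s + 1) →₀ ℕ) :=
  {withZ 0 1} ∪ Set.range (fun i : Fin s => withZ (Finsupp.single i 1) 1) ∪
    Set.range (fun j : Fin q => withZ (v j) 1)

/-- The polytope `Q = conv(0, e_1,…,e_s, v_1,…,v_q)` in `ℝ^s`. -/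
def polytopeQ {s q : ℕ} (v : Fin q → (Fin s →₀ ℕ)) : Set (Fin s → ℝ) :=
  convexHull ℝ ({0} ∪ Set.range (fun i : Fin s => (Pi.single i 1 : Fin s → ℝ)) ∪
    Set.range (fun (j : Fin q) (i : Fin s) => (v j i : ℝ)))

/-- The monomial subring `K[t^a | a ∈ F]` of a polynomial ring over `K`. -/
def monomialSubring (K : Type*) [Field K] {n : ℕ} (F : Set (Fin n →₀ ℕ)) :
    Subalgebra K (MvPolynomial (Fin n) K) :=
  Algebra.adjoin K ((fun a => MvPolynomial.monomial a (1 : K)) '' F)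

/-- The semigroup ring `K[ℕB]` of the semigroup `ℕB` spanned by `B`, inside `K[t_1,…,t_n]`. -/
def semigroupRing (K : Type*) [Field K] {n : ℕ} (B : Set (Fin n →₀ ℕ)) :
    Subalgebra K (MvPolynomial (Fin n) K) :=
  monomialSubring K (AddSubmonoid.closure B : Set (Fin n →₀ ℕ))

/-- The Ehrhart ring `K[t^α z^b | α ∈ ℤ^s ∩ bP]`, `b ∈ ℕ`, of a polytope `P` contained in the
nonnegative orthant (so that every such `α` is in `ℕ^s`), as a subring of `S[z]`. -/
def ehrhartRing (K : Type*) [Field K] {s : ℕ} (P : Set (Fin s → ℝ)) :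
    Subalgebra K (MvPolynomial (Fin (s + 1)) K) :=
  monomialSubring K {c | ∃ (a : Fin s →₀ ℕ) (b : ℕ),
    c = withZ a b ∧ (fun i => (a i : ℝ)) ∈ (b : ℝ) • P}

/-- The normalization of a subring `R` of a domain `T`: all elements of the field of fractions
of `R` that are integral over `R`. The field of fractions of `R` is realized as the subfield
of the field of fractions of `T` generated by `R`. -/
def normalization {K T : Type*} [Field K] [CommRing T] [IsDomain T] [Algebra K T]
    (R : Subalgebra K T) : Subring (FractionRing T) :=
  (Subfield.closure (algebraMap T (FractionRing T) '' (R : Set T))).toSubring ⊓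
    (integralClosure R (FractionRing T)).toSubring

/-- The system `x ≥ 0; xA ≤ 1` has the integer rounding property: for each integral vector `α`
for which `min {⟨y,1⟩ | y ≥ 0; Ay ≥ α}` exists (as a real number `r`), the minimum
`min {⟨y,1⟩ | y ∈ ℕ^q; Ay ≥ α}` exists and is equal to `⌈r⌉`. -/
def HasIntegerRoundingLE {s q : ℕ} (A : Matrix (Fin s) (Fin q) ℕ) : Prop :=
  ∀ (α : Fin s → ℤ) (r : ℝ),
    IsLeast {c : ℝ | ∃ y : Fin q → ℝ, 0 ≤ y ∧
      (fun i => (α i : ℝ)) ≤ (A.map (fun n : ℕ => (n : ℝ))).mulVec y ∧ c = ∑ j, y j} r →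
    IsLeast {c : ℤ | ∃ y : Fin q → ℕ,
      α ≤ (fun i => ((A.mulVec y i : ℕ) : ℤ)) ∧ c = ∑ j, (y j : ℤ)} ⌈r⌉

end

/-!
For an exponent `(a, b)`, membership in `ℕB` means that `a` is a sum of at most `b` vectors among
the `e_i` and the `v_j`, and membership in the cone over `Q` means that `a` is a nonnegative real
combination of these vectors with coefficients of total at most `b` (`mem_smul_polytopeQ_iff`). All
rings involved are spanned by monomials, so that everything is a comparison of these two semigroups.

*Normalization.* A real decomposition of a lattice point can be made rational: finitely many reals
are mapped to integers by an additive map that keeps the positive ones positive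
(`exists_addMonoidHom_integral_pos`). Hence a power of each monomial of the Ehrhart ring lies in
`K[ℕB]` (`exists_nsmul_mem_closure`), and the Ehrhart ring is integral over `K[ℕB]`. Conversely, an
element integral over `K[ℕB]` is a polynomial, since `S[z]` is factorial. An exponent of it outside
the cone over `Q` would be separated from `B` by a linear form, which the same additive maps make
integral (`exists_weight_of_notMem`). Grading by this form embeds `S[z]` into `S[z][T, T⁻¹]`, and
`S[z][T]` is integrally closed in the latter, so that such exponents cannot occur
(`weight_nonneg_of_isIntegral`).

*Integer rounding.* Since the `v_j` have degree two, the vectors below `v_j` are `0`, some `e_i` and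
`v_j`, all of which are available at the same cost. Both semigroups are therefore closed under
passing to smaller first components (`withZ_mem_closure_of_le`, `fracDecomp_of_le`), and an
inequality `a ≤ Ay` is as good as a decomposition of `a`. Apart from the variables dividing no
`t^{v_j}`, whose coefficients are forced to be integers, `(a, b)` lies in the cone over `Q` iff the
linear program for `a` has value at most `b`, and in `ℕB` iff the integer program does; so the two
semigroups agree iff rounding up the first value gives the second
(`hasIntegerRoundingLE_of_closure_eq`, `closure_eq_of_hasIntegerRoundingLE`).
-/

/-! ### Integral approximation of finitely many reals -/

/-- Finitely many reals can be sent to integers by an additive map that keeps the positive ones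
positive: a Hamel basis of `ℝ` over `ℚ` is moved to nearby rationals, and denominators are
cleared. -/
theorem exists_addMonoidHom_integral_pos (S : Finset ℝ) :
    ∃ f : ℝ →+ ℚ, ∀ x ∈ S, (0 < x → 0 < f x) ∧ ∃ z : ℤ, f x = z := by
  let β := Module.Basis.ofVectorSpace ℚ ℝ
  -- moving the basis by less than `δ` moves `x` by at most `δ` times the size of its coordinates
  obtain ⟨δ, hδ, hS⟩ : ∃ δ : ℝ, 0 < δ ∧
      ∀ x ∈ S, 0 < x → δ * ((β.repr x).sum fun _ c => |(c : ℝ)|) < x := by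
    have h : ∀ᶠ δ in nhdsWithin (0 : ℝ) (Set.Ioi 0),
        ∀ x ∈ S, 0 < x → δ * ((β.repr x).sum fun _ c => |(c : ℝ)|) < x := by
      rw [Filter.eventually_all_finset]
      intro x _
      by_cases hx : 0 < x
      · have hc : Filter.Tendsto (fun δ : ℝ => δ * ((β.repr x).sum fun _ c => |(c : ℝ)|))
            (nhdsWithin 0 (Set.Ioi 0)) (nhds 0) := by
          have : Continuous fun δ : ℝ => δ * ((β.repr x).sum fun _ c => |(c : ℝ)|) := by fun_prop
          simpa using (this.tendsto 0).mono_left nhdsWithin_le_nhds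
        filter_upwards [hc.eventually (gt_mem_nhds hx)] with δ h _ using h
      · exact Filter.Eventually.of_forall fun _ h => absurd h hx
    obtain ⟨δ, h1, h2⟩ := (h.and self_mem_nhdsWithin).exists
    exact ⟨δ, h2, h1⟩
  choose r hr using fun k => exists_rat_btwn (show β k - δ < β k by linarith)
  let g : ℝ →ₗ[ℚ] ℚ := β.constr ℚ r
  have hg : ∀ x, ((g x : ℚ) : ℝ) = (β.repr x).sum fun k c => (c : ℝ) * r k := by
    intro x
    simp [g, Module.Basis.constr_apply, Finsupp.sum]
  have hx : ∀ x, x = (β.repr x).sum fun k c => (c : ℝ) * β k := by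
    intro x
    conv_lhs => rw [← β.linearCombination_repr x]
    simp [Finsupp.linearCombination_apply, Rat.smul_def]
  have hpos : ∀ x ∈ S, 0 < x → 0 < g x := by
    intro x hxS h0
    have h1 := hS x hxS h0
    have h2 : x - g x ≤ δ * ((β.repr x).sum fun _ c => |(c : ℝ)|) := by
      rw [hg]
      nth_rw 1 [hx x]
      rw [Finsupp.sum, Finsupp.sum, Finsupp.sum, ← Finset.sum_sub_distrib, Finset.mul_sum]
      refine Finset.sum_le_sum fun k _ => ?_
      rw [← mul_sub, mul_comm δ]
      refine (le_abs_self _).trans ?_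
      rw [abs_mul]
      refine mul_le_mul_of_nonneg_left ?_ (abs_nonneg _)
      rw [abs_le]
      constructor <;> linarith [(hr k).1, (hr k).2]
    have : (0 : ℝ) < g x := by linarith
    exact_mod_cast this
  let N : ℕ := ∏ x ∈ S, (g x).den
  have hN : 0 < N := Finset.prod_pos fun x _ => (g x).den_pos
  refine ⟨((N : ℚ) • g).toAddMonoidHom, fun x hxS => ⟨fun h0 => ?_, ?_⟩⟩
  · have := hpos x hxS h0
    simp only [LinearMap.toAddMonoidHom_coe, LinearMap.smul_apply, smul_eq_mul]
    positivity
  · obtain ⟨c, hc⟩ : (g x).den ∣ N := Finset.dvd_prod_of_mem _ hxS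
    refine ⟨c * (g x).num, ?_⟩
    simp only [LinearMap.toAddMonoidHom_coe, LinearMap.smul_apply, smul_eq_mul]
    rw [hc]
    push_cast
    rw [mul_comm ((g x).den : ℚ), mul_assoc, Rat.den_mul_eq_num]

/-! ### Weights of integral elements -/

/-- `P[T]` is integrally closed in `P[T, T⁻¹]`, because the latter embeds into the fraction field
of `P[T]`. -/
theorem exists_toLaurent_eq_of_isIntegral {P : Type*} [CommRing P] [IsDomain P]
    [IsIntegrallyClosed (Polynomial P)] {g : LaurentPolynomial P}
    (hg : IsIntegral (Polynomial P) g) : ∃ p : Polynomial P, Polynomial.toLaurent p = g := by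
  let F := FractionRing (Polynomial P)
  have hX : IsUnit (algebraMap (Polynomial P) F Polynomial.X) := by
    rw [isUnit_iff_ne_zero]
    exact fun h => Polynomial.X_ne_zero
      (FaithfulSMul.algebraMap_injective (Polynomial P) F (by rw [h, map_zero]))
  have hM : ∀ y : Submonoid.powers (Polynomial.X : Polynomial P),
      IsUnit (algebraMap (Polynomial P) F y) := by
    rintro ⟨_, n, rfl⟩
    simp only [map_pow]
    exact hX.pow n
  let ψ : LaurentPolynomial P →+* F := IsLocalization.lift hM
  have hψ : ∀ p : Polynomial P, ψ (Polynomial.toLaurent p) = algebraMap _ F p := fun p =>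
    IsLocalization.lift_eq hM p
  have hinj : Function.Injective ψ := by
    refine (IsLocalization.lift_injective_iff hM).2 fun x y => ?_
    rw [(FaithfulSMul.algebraMap_injective (Polynomial P) F).eq_iff]
    exact Polynomial.toLaurent_inj x y
  have hint : IsIntegral (Polynomial P) (ψ g) := by
    refine hg.map_of_comp_eq (RingHom.id _) ψ ?_
    exact RingHom.ext fun p => (hψ p).symm
  obtain ⟨p, hp⟩ := IsIntegrallyClosed.isIntegral_iff.1 hint
  exact ⟨p, hinj ((hψ p).trans hp)⟩

/-- Integral weights which are nonnegative on the exponents in `F` are nonnegative on all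
exponents that occur in a polynomial integral over `K[t^a | a ∈ F]`. The substitution
`t_i ↦ t_i T^{W_i}` maps `K[t^a | a ∈ F]` into the integrally closed ring `K[t][T]`, so the image
of such a polynomial has no negative powers of `T`. -/
theorem weight_nonneg_of_isIntegral {K : Type*} [Field K] {n : ℕ} {F : Set (Fin n →₀ ℕ)}
    (W : Fin n → ℤ) (hF : ∀ a ∈ F, 0 ≤ ∑ i, (a i : ℤ) * W i) {f : MvPolynomial (Fin n) K}
    (hf : IsIntegral (monomialSubring K F) f) {c : Fin n →₀ ℕ} (hc : c ∈ f.support) :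
    0 ≤ ∑ i, (c i : ℤ) * W i := by
  let P := MvPolynomial (Fin n) K
  let Φ : P →ₐ[K] LaurentPolynomial P :=
    MvPolynomial.aeval fun i => LaurentPolynomial.C (MvPolynomial.X i) * LaurentPolynomial.T (W i)
  have hΦ : ∀ (a : Fin n →₀ ℕ) (k : K), Φ (MvPolynomial.monomial a k) =
      LaurentPolynomial.C (MvPolynomial.monomial a k) *
        LaurentPolynomial.T (∑ i, (a i : ℤ) * W i) := by
    intro a k
    rw [MvPolynomial.aeval_monomial, Finsupp.prod_fintype _ _ (by simp), MvPolynomial.monomial_eq,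
      Finsupp.prod_fintype _ _ (by simp)]
    have hT : ∀ s : Finset (Fin n), (LaurentPolynomial.T (∑ i ∈ s, (a i : ℤ) * W i) :
        LaurentPolynomial P) = ∏ i ∈ s, LaurentPolynomial.T (W i) ^ a i := by
      intro s
      induction s using Finset.induction_on with
      | empty => simp
      | insert i s hi ih =>
        rw [Finset.sum_insert hi, Finset.prod_insert hi, LaurentPolynomial.T_add, ih,
          LaurentPolynomial.T_pow]
    rw [hT]
    simp only [mul_pow, Finset.prod_mul_distrib, map_mul, map_prod, map_pow, ← mul_assoc]
    rfl
  have hR : ∀ r ∈ monomialSubring K F,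
      Φ r ∈ (Polynomial.toLaurentAlg (R := P)).toRingHom.range := by
    have : monomialSubring K F ≤
        ((Polynomial.toLaurentAlg (R := P)).range.restrictScalars K).comap Φ := by
      refine Algebra.adjoin_le ?_
      rintro _ ⟨a, ha, rfl⟩
      obtain ⟨m, hm⟩ := Int.eq_ofNat_of_zero_le (hF a ha)
      refine ⟨Polynomial.C (MvPolynomial.monomial a 1) * Polynomial.X ^ m, ?_⟩
      simp [hΦ, hm]
    exact fun r hr => this hr
  let e := RingEquiv.ofBijective (Polynomial.toLaurentAlg (R := P)).toRingHom.rangeRestrict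
    ⟨fun x y h => Polynomial.toLaurent_injective (congrArg Subtype.val h),
      RingHom.rangeRestrict_surjective _⟩
  let ρ : monomialSubring K F →+* Polynomial P := e.symm.toRingHom.comp
    ((Φ.toRingHom.comp (monomialSubring K F).val.toRingHom).codRestrict _ fun r => hR r r.2)
  have hint : IsIntegral (Polynomial P) (Φ f) := by
    refine hf.map_of_comp_eq ρ Φ.toRingHom ?_
    ext r : 1
    exact congrArg Subtype.val (e.apply_symm_apply ⟨Φ r, hR r r.2⟩)
  obtain ⟨p, hp⟩ := exists_toLaurent_eq_of_isIntegral hint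
  by_contra! hneg
  set w := ∑ i, (c i : ℤ) * W i
  have h0 : (Φ f).coeff w = 0 := by
    rw [← hp, ← Finsupp.notMem_support_iff, LaurentPolynomial.support_coeff_toLaurent]
    simp only [Finset.mem_map, not_exists, not_and]
    intro m _ hm
    simp at hm
    omega
  have h1 : ∀ g : P, MvPolynomial.coeff c ((Φ g).coeff w) = MvPolynomial.coeff c g := by
    intro g
    induction g using MvPolynomial.induction_on' with
    | monomial a k =>
      rw [hΦ, ← LaurentPolynomial.single_eq_C_mul_T, AddMonoidAlgebra.coeff_single,
        MvPolynomial.coeff_monomial]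
      by_cases hac : a = c
      · subst hac
        simp [w]
      · simp only [Finsupp.single_apply]
        split_ifs <;> simp [MvPolynomial.coeff_monomial, hac]
    | add p q hp hq =>
      rw [map_add, AddMonoidAlgebra.coeff_add, Finsupp.add_apply]
      exact (MvPolynomial.coeff_add c _ _).trans (congrArg₂ (· + ·) hp hq)
  replace h1 := h1 f
  rw [h0] at h1
  exact (MvPolynomial.mem_support_iff.1 hc) (by simpa using h1.symm)

/-! ### Fractional decompositions and the polytope -/

/-- `x` is a combination of the `e_i` and the `v_j` with nonnegative real coefficients (`l_i` and
`y_j`) of total at most `c`. For `c ≥ 0` this describes the dilation `c • Q` of the polytope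
`Q = conv(0, e_1,…,e_s, v_1,…,v_q)`. -/
def FracDecomp {s q : ℕ} (v : Fin q → (Fin s →₀ ℕ)) (x : Fin s → ℝ) (c : ℝ) : Prop :=
  ∃ (l : Fin s → ℝ) (y : Fin q → ℝ), 0 ≤ l ∧ 0 ≤ y ∧
    (∀ i, x i = l i + ∑ j, y j * v j i) ∧ ∑ i, l i + ∑ j, y j ≤ c

section Decomposition

variable {s q : ℕ} {v : Fin q → (Fin s →₀ ℕ)}

theorem FracDecomp.add {x x' : Fin s → ℝ} {c c' : ℝ} (h : FracDecomp v x c)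
    (h' : FracDecomp v x' c') : FracDecomp v (x + x') (c + c') := by
  obtain ⟨l, y, hl, hy, hx, hc⟩ := h
  obtain ⟨l', y', hl', hy', hx', hc'⟩ := h'
  refine ⟨l + l', y + y', add_nonneg hl hl', add_nonneg hy hy', fun i => ?_, ?_⟩
  · simp only [Pi.add_apply, hx, hx', add_mul, Finset.sum_add_distrib]
    ring
  · simp only [Pi.add_apply, Finset.sum_add_distrib]
    linarith

theorem FracDecomp.smul {x : Fin s → ℝ} {c t : ℝ} (ht : 0 ≤ t) (h : FracDecomp v x c) :
    FracDecomp v (t • x) (t * c) := by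
  obtain ⟨l, y, hl, hy, hx, hc⟩ := h
  refine ⟨t • l, t • y, smul_nonneg ht hl, smul_nonneg ht hy, fun i => ?_, ?_⟩
  · simp only [Pi.smul_apply, smul_eq_mul, hx, mul_add, Finset.mul_sum, mul_assoc]
  · simp only [Pi.smul_apply, smul_eq_mul, ← Finset.mul_sum, ← mul_add]
    exact mul_le_mul_of_nonneg_left hc ht

theorem FracDecomp.mono {x : Fin s → ℝ} {c c' : ℝ} (h : FracDecomp v x c) (hc : c ≤ c') :
    FracDecomp v x c' := by
  obtain ⟨l, y, hl, hy, hx, hc'⟩ := h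
  exact ⟨l, y, hl, hy, hx, hc'.trans hc⟩

theorem zero_mem_polytopeQ : (0 : Fin s → ℝ) ∈ polytopeQ v :=
  subset_convexHull _ _ (by simp)

theorem single_mem_polytopeQ (i : Fin s) : (Pi.single i 1 : Fin s → ℝ) ∈ polytopeQ v :=
  subset_convexHull _ _ (by simp)

theorem column_mem_polytopeQ (j : Fin q) : (fun i => (v j i : ℝ)) ∈ polytopeQ v :=
  subset_convexHull _ _ (Or.inr ⟨j, rfl⟩)

theorem convex_polytopeQ : Convex ℝ (polytopeQ v) :=
  convex_convexHull ℝ _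

theorem sum_smul_mem_smul_of_convex {E ι : Type*} [AddCommGroup E] [Module ℝ E] {Q : Set E}
    (hQ : Convex ℝ Q) (h0 : (0 : E) ∈ Q) (S : Finset ι) (t : ι → ℝ) (p : ι → E)
    (ht : ∀ k ∈ S, 0 ≤ t k) (hp : ∀ k ∈ S, p k ∈ Q) :
    ∑ k ∈ S, t k • p k ∈ (∑ k ∈ S, t k) • Q := by
  classical
  induction S using Finset.induction_on with
  | empty => exact ⟨0, h0, by simp⟩
  | insert k S hk ih =>
    simp only [Finset.mem_insert, forall_eq_or_imp] at ht hp
    rw [Finset.sum_insert hk, Finset.sum_insert hk,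
      hQ.add_smul ht.1 (Finset.sum_nonneg ht.2)]
    exact Set.add_mem_add (Set.smul_mem_smul_set hp.1) (ih ht.2 hp.2)

theorem mem_smul_polytopeQ_iff {x : Fin s → ℝ} {c : ℝ} (hc : 0 ≤ c) :
    x ∈ c • polytopeQ v ↔ FracDecomp v x c := by
  constructor
  · rintro ⟨p, hp, rfl⟩
    suffices h : polytopeQ v ⊆ {x | FracDecomp v x 1} by
      simpa using FracDecomp.smul hc (h hp)
    refine convexHull_min ?_ ?_
    · rintro _ ((h | ⟨i, rfl⟩) | ⟨j, rfl⟩)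
      · rw [Set.mem_singleton_iff] at h
        subst h
        exact ⟨0, 0, le_rfl, le_rfl, by simp, by simp⟩
      · exact ⟨Pi.single i 1, 0, by simp [Pi.single_nonneg], le_rfl, by simp, by simp⟩
      · refine ⟨0, Pi.single j 1, le_rfl, by simp [Pi.single_nonneg], ?_, by simp⟩
        simp [Pi.single_apply]
    · intro x hx y hy a b ha hb hab
      simpa [hab] using (FracDecomp.smul ha hx).add (FracDecomp.smul hb hy)
  · rintro ⟨l, y, hl, hy, hx, hle⟩
    have h1 := sum_smul_mem_smul_of_convex (Q := polytopeQ v) convex_polytopeQ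
      zero_mem_polytopeQ Finset.univ l (fun i => Pi.single i 1) (fun i _ => hl i)
      fun i _ => single_mem_polytopeQ i
    have h2 := sum_smul_mem_smul_of_convex (Q := polytopeQ v) convex_polytopeQ
      zero_mem_polytopeQ Finset.univ y (fun j i => (v j i : ℝ)) (fun j _ => hy j)
      fun j _ => column_mem_polytopeQ j
    have h3 : (0 : Fin s → ℝ) ∈ (c - (∑ i, l i + ∑ j, y j)) • polytopeQ v :=
      ⟨0, zero_mem_polytopeQ, by simp⟩
    have hls : 0 ≤ ∑ i, l i := Finset.sum_nonneg fun i _ => hl i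
    have hys : 0 ≤ ∑ j, y j := Finset.sum_nonneg fun j _ => hy j
    have h4 := Set.add_mem_add (Set.add_mem_add h1 h2) h3
    rw [← convex_polytopeQ.add_smul hls hys,
      ← convex_polytopeQ.add_smul (add_nonneg hls hys) (by linarith), add_sub_cancel,
      add_zero] at h4
    convert h4 using 1
    funext i
    simp [hx i, Finset.sum_apply, Pi.single_apply]

/-- A monomial of degree two, scaled down coordinatewise by factors `θ_i ∈ [0, 1]`, stays in the
convex hull of `0`, the `e_i` and its exponent: with `v = e_k + e_l`, the part `min(θ_k, θ_l)` is
spent on `v`, and what remains is a multiple of `e_k` or of `e_l`. -/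
theorem exists_decomp_of_degree_eq_two {a : Fin s →₀ ℕ} (ha : a.degree = 2) {θ : Fin s → ℝ}
    (h0 : ∀ i, 0 ≤ θ i) (h1 : ∀ i, θ i ≤ 1) :
    ∃ (τ : ℝ) (l : Fin s → ℝ), 0 ≤ τ ∧ 0 ≤ l ∧ (∀ i, θ i * a i = l i + τ * a i) ∧
      ∑ i, l i + τ ≤ 1 := by
  obtain ⟨k, l, rfl⟩ : ∃ k l, a = Finsupp.single k 1 + Finsupp.single l 1 := by
    have hcard : Multiset.card (Finsupp.toMultiset a) = 2 := by
      rw [Finsupp.card_toMultiset, ← ha, Finsupp.degree_apply]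
      rfl
    obtain ⟨k, l, hkl⟩ := Multiset.card_eq_two.1 hcard
    refine ⟨k, l, Multiset.toFinsupp.symm.injective (a₁ := a) ?_⟩
    change Finsupp.toMultiset a = Finsupp.toMultiset _
    rw [hkl, map_add, Finsupp.toMultiset_single, Finsupp.toMultiset_single, one_smul, one_smul]
    rfl
  have hk := min_le_left (θ k) (θ l)
  have hl := min_le_right (θ k) (θ l)
  refine ⟨min (θ k) (θ l), fun i => (if k = i then θ k - min (θ k) (θ l) else 0) +
    (if l = i then θ l - min (θ k) (θ l) else 0), le_min (h0 k) (h0 l), fun i => ?_,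
    fun i => ?_, ?_⟩
  · refine add_nonneg ?_ ?_ <;> split_ifs <;> simp
  · simp only [Finsupp.add_apply, Finsupp.single_apply]
    push_cast
    split_ifs with h2 h3 h3
    · subst h2; subst h3; ring
    · subst h2; ring
    · subst h3; ring
    · ring
  · simp only [Finset.sum_add_distrib, Finset.sum_ite_eq, Finset.mem_univ, if_true]
    rcases min_choice (θ k) (θ l) with h | h <;> rw [h] <;> linarith [h1 k, h1 l]

/-- Dilations of the polytope are closed under passing to smaller nonnegative vectors: each column
used is scaled down, in coordinate `i`, by the common factor `x_i / (Ay)_i`. -/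
theorem fracDecomp_of_le (hdeg : ∀ j, (v j).degree = 2) {x : Fin s → ℝ} {y : Fin q → ℝ}
    (hy : 0 ≤ y) (hx0 : 0 ≤ x) (hx : ∀ i, x i ≤ ∑ j, y j * v j i) :
    FracDecomp v x (∑ j, y j) := by
  have hA : ∀ i, 0 ≤ ∑ j, y j * (v j i : ℝ) := fun i => (hx0 i).trans (hx i)
  choose τ l hτ hl heq hle using fun j => exists_decomp_of_degree_eq_two (hdeg j)
    (θ := fun i => x i / ∑ j, y j * v j i) (fun i => div_nonneg (hx0 i) (hA i))
    (fun i => div_le_one_of_le₀ (hx i) (hA i))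
  refine ⟨fun i => ∑ j, y j * l j i, fun j => y j * τ j, fun i => ?_, fun j => ?_, fun i => ?_, ?_⟩
  · exact Finset.sum_nonneg fun j _ => mul_nonneg (hy j) (hl j i)
  · exact mul_nonneg (hy j) (hτ j)
  · have h : ∑ j, y j * ((x i / ∑ j, y j * v j i) * v j i) = x i := by
      have h' : ∑ j, y j * ((x i / ∑ j, y j * v j i) * v j i) =
          (x i / ∑ j, y j * v j i) * ∑ j, y j * v j i := by
        rw [Finset.mul_sum]
        exact Finset.sum_congr rfl fun j _ => by ring
      rw [h']
      rcases (hA i).eq_or_lt with h0 | h0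
      -- if `(Ay)_i = 0` then `x_i = 0`, which agrees with the value of the division by zero
      · rw [← h0, mul_zero]
        exact le_antisymm (hx0 i) (h0 ▸ hx i)
      · exact div_mul_cancel₀ _ h0.ne'
    rw [← Finset.sum_add_distrib]
    nth_rw 1 [← h]
    refine Finset.sum_congr rfl fun j _ => ?_
    rw [heq j i]
    ring
  · rw [Finset.sum_comm, ← Finset.sum_add_distrib]
    refine Finset.sum_le_sum fun j _ => ?_
    rw [← Finset.mul_sum, ← mul_add]
    exact mul_le_of_le_one_right (hy j) (hle j)

/-! ### The semigroup generated by `B` -/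

@[simp]
theorem withZ_castSucc (a : Fin s →₀ ℕ) (b : ℕ) (i : Fin s) : withZ a b i.castSucc = a i := by
  simp [withZ, Finsupp.mapDomain_apply (Fin.castSucc_injective s)]

@[simp]
theorem withZ_last (a : Fin s →₀ ℕ) (b : ℕ) : withZ a b (Fin.last s) = b := by
  have : Fin.last s ∉ Set.range (Fin.castSucc : Fin s → Fin (s + 1)) := by
    rintro ⟨i, hi⟩
    exact (Fin.castSucc_lt_last i).ne hi
  simp [withZ, Finsupp.mapDomain_of_notMem_range _ _ this]

theorem withZ_add (a a' : Fin s →₀ ℕ) (b b' : ℕ) :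
    withZ (a + a') (b + b') = withZ a b + withZ a' b' := by
  simp only [withZ, Finsupp.mapDomain_add, Finsupp.single_add]
  abel

theorem withZ_nsmul (n : ℕ) (a : Fin s →₀ ℕ) (b : ℕ) : withZ (n • a) (n * b) = n • withZ a b := by
  ext i
  refine Fin.lastCases ?_ (fun i => ?_) i <;> simp

theorem withZ_inj {a a' : Fin s →₀ ℕ} {b b' : ℕ} (h : withZ a b = withZ a' b') :
    a = a' ∧ b = b' := by
  constructor
  · ext i
    simpa using DFunLike.congr_fun h i.castSucc
  · simpa using DFunLike.congr_fun h (Fin.last s)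

theorem exists_eq_withZ (c : Fin (s + 1) →₀ ℕ) : ∃ a b, c = withZ a b := by
  refine ⟨c.comapDomain Fin.castSucc (Fin.castSucc_injective s).injOn, c (Fin.last s), ?_⟩
  ext i
  refine Fin.lastCases ?_ (fun i => ?_) i <;> simp

theorem withZ_zero_mem_closure (b : ℕ) : withZ 0 b ∈ AddSubmonoid.closure (setB v) := by
  have h := AddSubmonoid.nsmul_mem _
    (AddSubmonoid.subset_closure (s := setB v) (Or.inl (Or.inl rfl))) b
  rwa [← withZ_nsmul, smul_zero, mul_one] at h

theorem withZ_sum_nsmul_mem_closure {ι : Type*} (S : Finset ι) (m : ι → ℕ) (g : ι → (Fin s →₀ ℕ))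
    (hg : ∀ k, withZ (g k) 1 ∈ setB v) :
    withZ (∑ k ∈ S, m k • g k) (∑ k ∈ S, m k) ∈ AddSubmonoid.closure (setB v) := by
  classical
  induction S using Finset.induction_on with
  | empty => simpa using withZ_zero_mem_closure 0
  | insert k S hk ih =>
    rw [Finset.sum_insert hk, Finset.sum_insert hk, withZ_add]
    refine add_mem ?_ ih
    have h := AddSubmonoid.nsmul_mem _ (AddSubmonoid.subset_closure (hg k)) (m k)
    rwa [← withZ_nsmul, mul_one] at h

theorem withZ_mem_closure_of_decomp {a : Fin s →₀ ℕ} {b : ℕ} {m : Fin s → ℕ} {y : Fin q → ℕ}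
    (ha : ∀ i, a i = m i + ∑ j, y j * v j i) (hb : ∑ i, m i + ∑ j, y j ≤ b) :
    withZ a b ∈ AddSubmonoid.closure (setB v) := by
  have h1 := withZ_sum_nsmul_mem_closure (v := v) Finset.univ m (fun i => Finsupp.single i 1)
    fun i => Or.inl (Or.inr ⟨i, rfl⟩)
  have h2 := withZ_sum_nsmul_mem_closure (v := v) Finset.univ y v fun j => Or.inr ⟨j, rfl⟩
  have h3 := add_mem (add_mem h1 h2) (withZ_zero_mem_closure (v := v) (b - (∑ i, m i + ∑ j, y j)))
  rw [← withZ_add, ← withZ_add, add_zero, Nat.add_sub_cancel' hb] at h3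
  convert h3 using 2
  ext i
  simp [ha, Finsupp.single_apply]

/-- If `t^a z^b` lies in `K[ℕB]`, then so does `t^{a'} z^b` for every divisor `t^{a'}` of `t^a`:
a proper divisor of a monomial of degree two is `1` or a variable. -/
theorem withZ_mem_closure_of_le (hdeg : ∀ j, (v j).degree = 2) {a a' : Fin s →₀ ℕ} {b : ℕ}
    (h : withZ a b ∈ AddSubmonoid.closure (setB v)) (ha : a' ≤ a) :
    withZ a' b ∈ AddSubmonoid.closure (setB v) := by
  suffices H : ∀ c ∈ AddSubmonoid.closure (setB v), ∀ a a' : Fin s →₀ ℕ, ∀ b : ℕ, c = withZ a b →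
      a' ≤ a → withZ a' b ∈ AddSubmonoid.closure (setB v) from H _ h _ _ _ rfl ha
  clear h ha a a' b
  intro c hc
  induction hc using AddSubmonoid.closure_induction with
  | mem c hc =>
    intro a a' b hab ha
    have hsmall : a'.degree ≤ 1 → b = 1 → withZ a' b ∈ AddSubmonoid.closure (setB v) := by
      rintro hd rfl
      refine withZ_mem_closure_of_decomp (m := a') (y := 0) (by simp) ?_
      simpa [Finsupp.degree_eq_sum] using hd
    have hle : a'.degree ≤ a.degree := Finsupp.degree_mono ha
    rcases hc with (hc | ⟨i, rfl⟩) | ⟨j, rfl⟩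
    · obtain ⟨rfl, rfl⟩ := withZ_inj ((Set.mem_singleton_iff.1 hc).symm.trans hab)
      exact hsmall (hle.trans (by simp)) rfl
    · obtain ⟨rfl, rfl⟩ := withZ_inj hab
      exact hsmall (hle.trans (by simp)) rfl
    · obtain ⟨rfl, rfl⟩ := withZ_inj hab
      obtain ⟨d, hd⟩ := exists_add_of_le ha
      have hsum : (v j).degree = a'.degree + d.degree := by rw [hd, map_add]
      by_cases h0 : d.degree = 0
      · rw [Finsupp.degree_eq_zero_iff] at h0
        subst h0
        rw [add_zero] at hd
        rw [← hd]
        exact AddSubmonoid.subset_closure (Or.inr ⟨j, rfl⟩)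
      · have := hdeg j
        exact hsmall (by omega) rfl
  | zero =>
    intro a a' b hab ha
    obtain ⟨rfl, rfl⟩ := withZ_inj (a := 0) (b := 0) (by simpa [withZ] using hab)
    rw [nonpos_iff_eq_zero.1 ha]
    exact withZ_zero_mem_closure 0
  | add c c' _ _ ih ih' =>
    intro a a' b hab ha
    obtain ⟨a₁, b₁, rfl⟩ := exists_eq_withZ c
    obtain ⟨a₂, b₂, rfl⟩ := exists_eq_withZ c'
    rw [← withZ_add] at hab
    obtain ⟨rfl, rfl⟩ := withZ_inj hab
    have h : a' = a' ⊓ a₁ + (a' - a' ⊓ a₁) := (add_tsub_cancel_of_le inf_le_left).symm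
    rw [h, withZ_add]
    refine add_mem (ih _ _ _ rfl inf_le_right) (ih' _ _ _ rfl ?_)
    intro i
    have := ha i
    simp only [Finsupp.coe_add, Pi.add_apply, Finsupp.coe_tsub, Pi.sub_apply,
      Finsupp.inf_apply] at this ⊢
    omega

end Decomposition

/-! ### Monomial subrings -/

section Rings

variable {K : Type*} [Field K] {s q n : ℕ}

theorem support_subset_of_mem_monomialSubring {M : AddSubmonoid (Fin n →₀ ℕ)}
    {f : MvPolynomial (Fin n) K} (hf : f ∈ monomialSubring K (M : Set (Fin n →₀ ℕ))) :
    ∀ c ∈ f.support, c ∈ M := by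
  classical
  induction hf using Algebra.adjoin_induction with
  | mem f hf =>
    obtain ⟨a, ha, rfl⟩ := hf
    intro c hc
    rw [Finset.mem_singleton.1 (MvPolynomial.support_monomial_subset hc)]
    exact ha
  | algebraMap r =>
    intro c hc
    rw [MvPolynomial.algebraMap_eq, MvPolynomial.C_apply] at hc
    rw [Finset.mem_singleton.1 (MvPolynomial.support_monomial_subset hc)]
    exact M.zero_mem
  | add f g _ _ ihf ihg =>
    intro c hc
    rcases Finset.mem_union.1 (MvPolynomial.support_add hc) with h | h
    exacts [ihf c h, ihg c h]
  | mul f g _ _ ihf ihg =>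
    intro c hc
    obtain ⟨a, ha, b, hb, rfl⟩ := Finset.mem_add.1 (MvPolynomial.support_mul f g hc)
    exact M.add_mem (ihf a ha) (ihg b hb)

theorem mem_monomialSubring_of_support_subset {F : Set (Fin n →₀ ℕ)}
    {f : MvPolynomial (Fin n) K} (hf : ∀ c ∈ f.support, c ∈ F) : f ∈ monomialSubring K F := by
  rw [f.as_sum]
  refine sum_mem fun c hc => ?_
  have h : MvPolynomial.monomial c (f.coeff c) = f.coeff c • MvPolynomial.monomial c (1 : K) := by
    simp [MvPolynomial.smul_monomial]
  rw [h]
  have hmem : MvPolynomial.monomial c (1 : K) ∈ monomialSubring K F :=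
    Algebra.subset_adjoin ⟨c, hf c hc, rfl⟩
  exact Subalgebra.smul_mem _ hmem _

theorem monomial_mem_monomialSubring_iff {M : AddSubmonoid (Fin n →₀ ℕ)} {c : Fin n →₀ ℕ} :
    MvPolynomial.monomial c (1 : K) ∈ monomialSubring K (M : Set (Fin n →₀ ℕ)) ↔ c ∈ M := by
  classical
  refine ⟨fun h => support_subset_of_mem_monomialSubring h c ?_, fun h =>
    Algebra.subset_adjoin ⟨c, h, rfl⟩⟩
  simp [MvPolynomial.mem_support_iff]

theorem monomialSubring_inj {M N : AddSubmonoid (Fin n →₀ ℕ)} :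
    monomialSubring K (M : Set (Fin n →₀ ℕ)) = monomialSubring K (N : Set (Fin n →₀ ℕ)) ↔
      M = N := by
  refine ⟨fun h => ?_, fun h => by rw [h]⟩
  ext c
  rw [← monomial_mem_monomialSubring_iff (K := K), h, monomial_mem_monomialSubring_iff]

variable {v : Fin q → (Fin s →₀ ℕ)}

/-- The semigroup of the exponents `(α, b)` with `α ∈ bQ`, whose semigroup ring is the Ehrhart
ring of `Q`. -/
def ehrhartSemigroup (v : Fin q → (Fin s →₀ ℕ)) : AddSubmonoid (Fin (s + 1) →₀ ℕ) where
  carrier := {c | ∃ (a : Fin s →₀ ℕ) (b : ℕ),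
    c = withZ a b ∧ (fun i => (a i : ℝ)) ∈ (b : ℝ) • polytopeQ v}
  zero_mem' := ⟨0, 0, by simp [withZ], 0, zero_mem_polytopeQ, by ext; simp⟩
  add_mem' := by
    rintro _ _ ⟨a, b, rfl, h⟩ ⟨a', b', rfl, h'⟩
    refine ⟨a + a', b + b', (withZ_add _ _ _ _).symm, ?_⟩
    rw [Nat.cast_add, convex_polytopeQ.add_smul
      (Nat.cast_nonneg b) (Nat.cast_nonneg b')]
    convert Set.add_mem_add h h' using 1
    ext i
    simp

theorem withZ_mem_ehrhartSemigroup {a : Fin s →₀ ℕ} {b : ℕ} :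
    withZ a b ∈ ehrhartSemigroup v ↔ FracDecomp v (fun i => (a i : ℝ)) b := by
  rw [← mem_smul_polytopeQ_iff (Nat.cast_nonneg b)]
  constructor
  · rintro ⟨a', b', h, h'⟩
    obtain ⟨rfl, rfl⟩ := withZ_inj h
    exact h'
  · exact fun h => ⟨a, b, rfl, h⟩

theorem ehrhartRing_eq : ehrhartRing K (polytopeQ v) =
    monomialSubring K (ehrhartSemigroup v : Set (Fin (s + 1) →₀ ℕ)) := rfl

theorem closure_setB_le_ehrhartSemigroup :
    AddSubmonoid.closure (setB v) ≤ ehrhartSemigroup v := by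
  rw [AddSubmonoid.closure_le]
  rintro _ ((h | ⟨i, rfl⟩) | ⟨j, rfl⟩)
  · rw [Set.mem_singleton_iff] at h
    subst h
    exact ⟨0, 1, rfl, 0, zero_mem_polytopeQ, by ext; simp⟩
  · refine ⟨_, 1, rfl, _, single_mem_polytopeQ i, ?_⟩
    ext k
    simp [Finsupp.single_apply, Pi.single_apply, eq_comm]
  · exact ⟨_, 1, rfl, _, column_mem_polytopeQ j, by ext; simp⟩

/-! ### Normalization -/

/-- Some multiple of every point of the Ehrhart semigroup lies in `ℕB`: an additive map
`ℝ → ℚ` that is integral and preserves positivity on the coefficients of a real decomposition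
turns it into a decomposition with coefficients in `ℕ`. -/
theorem exists_nsmul_mem_closure {a : Fin s →₀ ℕ} {b : ℕ}
    (h : withZ a b ∈ ehrhartSemigroup v) :
    ∃ N : ℕ, 0 < N ∧ N • withZ a b ∈ AddSubmonoid.closure (setB v) := by
  classical
  obtain ⟨l, y, hl, hy, hx, hle⟩ := withZ_mem_ehrhartSemigroup.1 h
  obtain ⟨f, hf⟩ := exists_addMonoidHom_integral_pos
    (insert 1 (insert ((b : ℝ) - (∑ i, l i + ∑ j, y j))
      (Finset.univ.image l ∪ Finset.univ.image y)))
  have hnat : ∀ x : ℝ, 0 ≤ x → ((0 < x → 0 < f x) ∧ ∃ z : ℤ, f x = z) →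
      ∃ m : ℕ, f x = m := by
    rintro x hx0 ⟨hpos, z, hz⟩
    have : 0 ≤ f x := by
      rcases hx0.eq_or_lt with rfl | h0
      · simp
      · exact (hpos h0).le
    rw [hz] at this
    obtain ⟨m, rfl⟩ := Int.eq_ofNat_of_zero_le (by exact_mod_cast this)
    exact ⟨m, by simpa using hz⟩
  obtain ⟨N, hN⟩ := hnat 1 zero_le_one (hf _ (by simp))
  obtain ⟨d, hd⟩ := hnat _ (sub_nonneg.2 hle) (hf _ (by simp))
  choose m hm using fun i => hnat (l i) (hl i) (hf _ (by simp))
  choose w hw using fun j => hnat (y j) (hy j) (hf _ (by simp))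
  have hmul : ∀ (k : ℕ) (x : ℝ), f (x * k) = f x * k := by
    intro k x
    rw [mul_comm, ← nsmul_eq_mul, map_nsmul, nsmul_eq_mul, mul_comm]
  have hcast : ∀ k : ℕ, f k = N * k := by
    intro k
    rw [← hN, ← hmul, one_mul]
  have hNpos : 0 < N := by
    have := (hf 1 (by simp)).1 one_pos
    rw [hN] at this
    exact_mod_cast this
  refine ⟨N, hNpos, ?_⟩
  rw [← withZ_nsmul]
  refine withZ_mem_closure_of_decomp (m := m) (y := w) (fun i => ?_) ?_
  · have := congrArg f (hx i)
    simp only [map_add, map_sum, hmul, hcast, hm, hw] at this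
    simp only [Finsupp.smul_apply, smul_eq_mul]
    exact_mod_cast this
  · rw [map_sub, map_add, map_sum, map_sum, hcast] at hd
    simp only [hm, hw] at hd
    have h1 : (N * b : ℚ) = (∑ i, m i + ∑ j, w j : ℕ) + d := by
      push_cast
      linarith
    have h2 : N * b = (∑ i, m i + ∑ j, w j) + d := by exact_mod_cast h1
    omega

/-- A point outside the Ehrhart semigroup is separated from `B` by an integral linear form. -/
theorem exists_weight_of_notMem {a : Fin s →₀ ℕ} {b : ℕ} (h : withZ a b ∉ ehrhartSemigroup v) :
    ∃ W : Fin (s + 1) → ℤ, (∀ c ∈ setB v, 0 ≤ ∑ i, (c i : ℤ) * W i) ∧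
      ∑ i, (withZ a b i : ℤ) * W i < 0 := by
  classical
  obtain ⟨w, u, hu, hs, hv, hab⟩ : ∃ (w : Fin s → ℝ) (u : ℝ), 0 < u ∧ (∀ i, 0 < w i + u) ∧
      (∀ j, 0 < ∑ i, (v j i : ℝ) * w i + u) ∧ ∑ i, (a i : ℝ) * w i + b * u < 0 := by
    -- for `b = 0` the polytope is shrunk to the origin, and `-∑ a_i` separates once `u` exceeds
    -- the degree of every `v_j`; for `b > 0` the point `a / b` is separated from `Q`
    rcases Nat.eq_zero_or_pos b with rfl | hb
    · refine ⟨fun _ => -1, 2 + ∑ j, ∑ i, (v j i : ℝ), by positivity, fun i => ?_, fun j => ?_, ?_⟩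
      · have : (0 : ℝ) ≤ ∑ j, ∑ i, (v j i : ℝ) := by positivity
        linarith
      · have : ∑ i, (v j i : ℝ) ≤ ∑ j, ∑ i, (v j i : ℝ) :=
          Finset.single_le_sum (f := fun j => ∑ i, (v j i : ℝ)) (fun j _ => by positivity)
            (Finset.mem_univ j)
        simp only [mul_neg, mul_one, Finset.sum_neg_distrib]
        linarith
      · obtain ⟨i, hi⟩ : ∃ i, a i ≠ 0 := by
          by_contra! h0
          obtain rfl : a = 0 := Finsupp.ext h0
          exact h ⟨0, 0, rfl, 0, zero_mem_polytopeQ, by ext; simp⟩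
        have h1 : (0 : ℝ) < ∑ i, (a i : ℝ) := Finset.sum_pos' (fun i _ => Nat.cast_nonneg _)
          ⟨i, Finset.mem_univ i, by exact_mod_cast Nat.pos_of_ne_zero hi⟩
        simpa using h1
    · have hb' : (0 : ℝ) < b := by exact_mod_cast hb
      have hx : (fun i => (a i : ℝ) / b) ∉ polytopeQ v := fun hmem =>
        h ⟨a, b, rfl, _, hmem, by ext i; simp [mul_div_cancel₀ _ hb'.ne']⟩
      have hclosed : IsClosed (polytopeQ v) :=
        Set.Finite.isClosed_convexHull ℝ (((Set.finite_singleton _).union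
          (Set.finite_range _)).union (Set.finite_range _))
      obtain ⟨g, u, hg, hgx⟩ :=
        geometric_hahn_banach_closed_point convex_polytopeQ hclosed hx
      have hgsum : ∀ x : Fin s → ℝ, g x = ∑ i, x i * g (Pi.single i 1) := by
        intro x
        conv_lhs => rw [← Finset.univ_sum_single x, map_sum]
        refine Finset.sum_congr rfl fun i _ => ?_
        rw [← smul_eq_mul, ← map_smul, ← Pi.single_smul, smul_eq_mul, mul_one]
      refine ⟨fun i => -g (Pi.single i 1), u, ?_, fun i => ?_, fun j => ?_, ?_⟩
      · simpa using hg 0 zero_mem_polytopeQ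
      · have := hg _ (single_mem_polytopeQ i)
        linarith
      · have := hg _ (column_mem_polytopeQ j)
        rw [hgsum] at this
        simp only [mul_neg, Finset.sum_neg_distrib]
        linarith
      · rw [hgsum] at hgx
        have h1 : ∑ i, (a i : ℝ) * g (Pi.single i 1) =
            b * ∑ i, (a i : ℝ) / b * g (Pi.single i 1) := by
          rw [Finset.mul_sum]
          refine Finset.sum_congr rfl fun i _ => ?_
          field_simp
        simp only [mul_neg, Finset.sum_neg_distrib]
        rw [h1]
        linarith [mul_lt_mul_of_pos_left hgx hb']
  let E : (Fin s →₀ ℕ) → ℕ → ℝ := fun c k => ∑ i, (c i : ℝ) * w i + k * u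
  obtain ⟨f, hf⟩ := exists_addMonoidHom_integral_pos
    (insert u (insert (-E a b) (Finset.univ.image w ∪ Finset.univ.image (fun i => w i + u) ∪
      Finset.univ.image fun j => E (v j) 1)))
  choose W hW using fun i => (hf (w i) (by simp)).2
  obtain ⟨U, hU⟩ := (hf u (by simp)).2
  have hE : ∀ c k, f (E c k) = ((∑ i, (c i : ℤ) * W i + k * U : ℤ) : ℚ) := by
    intro c k
    simp only [E, map_add, map_sum, ← nsmul_eq_mul, map_nsmul, hW, hU]
    push_cast
    simp
  let W' : Fin (s + 1) → ℤ := Fin.snoc (α := fun _ => ℤ) W U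
  have hsum : ∀ c k, ∑ i, (withZ c k i : ℤ) * W' i = ∑ i, (c i : ℤ) * W i + k * U := by
    intro c k
    simp [Fin.sum_univ_castSucc, W']
  refine ⟨W', ?_, ?_⟩
  · have hUpos : 0 ≤ U := by
      have := (hf u (by simp)).1 hu
      rw [hU] at this
      exact_mod_cast this.le
    rintro _ ((hc | ⟨i, rfl⟩) | ⟨j, rfl⟩)
    · rw [Set.mem_singleton_iff] at hc
      subst hc
      rw [hsum]
      simpa using hUpos
    · rw [hsum]
      have := (hf (w i + u) (by simp)).1 (hs i)
      rw [map_add, hW, hU] at this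
      have h' : 0 < W i + U := by exact_mod_cast this
      simpa [Finsupp.single_apply] using h'.le
    · rw [hsum]
      have := (hf (E (v j) 1) (by simp)).1 (by simpa [E] using hv j)
      rw [hE] at this
      exact_mod_cast this.le
  · rw [hsum]
    have := (hf (-E a b) (by simp)).1 (neg_pos.2 hab)
    rw [map_neg, hE] at this
    have h' : (0 : ℚ) > ((∑ i, (a i : ℤ) * W i + b * U : ℤ) : ℚ) := by linarith
    exact_mod_cast h'

theorem isIntegral_of_mem_ehrhartRing {f : MvPolynomial (Fin (s + 1)) K}
    (hf : f ∈ ehrhartRing K (polytopeQ v)) : IsIntegral (semigroupRing K (setB v)) f := by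
  suffices h : ehrhartRing K (polytopeQ v) ≤
      (integralClosure (semigroupRing K (setB v)) (MvPolynomial (Fin (s + 1)) K)).restrictScalars K
    from h hf
  refine Algebra.adjoin_le ?_
  rintro _ ⟨_, ⟨a, b, rfl, h⟩, rfl⟩
  obtain ⟨N, hN, hmem⟩ := exists_nsmul_mem_closure (v := v) ⟨a, b, rfl, h⟩
  refine IsIntegral.of_pow hN ?_
  rw [MvPolynomial.monomial_pow, one_pow]
  exact isIntegral_algebraMap (R := semigroupRing K (setB v))
    (x := ⟨_, monomial_mem_monomialSubring_iff.2 hmem⟩)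

theorem mem_ehrhartRing_of_isIntegral {f : MvPolynomial (Fin (s + 1)) K}
    (hf : IsIntegral (semigroupRing K (setB v)) f) : f ∈ ehrhartRing K (polytopeQ v) := by
  refine mem_monomialSubring_of_support_subset fun c hc => ?_
  by_contra hnot
  obtain ⟨a, b, rfl⟩ := exists_eq_withZ c
  obtain ⟨W, hW, hlt⟩ := exists_weight_of_notMem (v := v) hnot
  refine hlt.not_ge (weight_nonneg_of_isIntegral W (fun c hc => ?_) hf hc)
  induction hc using AddSubmonoid.closure_induction with
  | mem c hc => exact hW c hc
  | zero => simp
  | add c c' _ _ h h' =>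
    simp only [Finsupp.add_apply, Nat.cast_add, add_mul, Finset.sum_add_distrib]
    exact add_nonneg h h'

/-- The fraction field of `K[ℕB]` is that of `S[z]`, because it contains `z` and the quotients
`t_i = t_i z / z`. -/
theorem subfieldClosure_semigroupRing_eq_top :
    Subfield.closure (algebraMap (MvPolynomial (Fin (s + 1)) K)
      (FractionRing (MvPolynomial (Fin (s + 1)) K)) ''
        (semigroupRing K (setB v) : Set (MvPolynomial (Fin (s + 1)) K))) = ⊤ := by
  set P := MvPolynomial (Fin (s + 1)) K
  set L := Subfield.closure (algebraMap P (FractionRing P) ''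
    (semigroupRing K (setB v) : Set P)) with hL
  have hmem : ∀ f ∈ semigroupRing K (setB v), algebraMap P (FractionRing P) f ∈ L :=
    fun f hf => Subfield.subset_closure ⟨f, hf, rfl⟩
  have hz : algebraMap P (FractionRing P) (MvPolynomial.X (Fin.last s)) ∈ L := by
    refine hmem _ (monomial_mem_monomialSubring_iff.2 (AddSubmonoid.subset_closure ?_))
    exact Or.inl (Or.inl (by simp [withZ]))
  have hX : ∀ i, algebraMap P (FractionRing P) (MvPolynomial.X i) ∈ L := by
    refine Fin.lastCases hz fun i => ?_
    have h1 : algebraMap P (FractionRing P)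
        (MvPolynomial.X i.castSucc * MvPolynomial.X (Fin.last s)) ∈ L := by
      refine hmem _ ?_
      have h2 : (MvPolynomial.X i.castSucc * MvPolynomial.X (Fin.last s) : P) =
          MvPolynomial.monomial (withZ (Finsupp.single i 1) 1) 1 := by
        rw [withZ, Finsupp.mapDomain_single, MvPolynomial.X, MvPolynomial.X,
          MvPolynomial.monomial_mul, one_mul]
      rw [h2]
      exact monomial_mem_monomialSubring_iff.2
        (AddSubmonoid.subset_closure (Or.inl (Or.inr ⟨i, rfl⟩)))
    have h0 : algebraMap P (FractionRing P) (MvPolynomial.X (Fin.last s)) ≠ 0 := by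
      intro h
      rw [← map_zero (algebraMap P (FractionRing P))] at h
      exact MvPolynomial.X_ne_zero _ (FaithfulSMul.algebraMap_injective P (FractionRing P) h)
    have h2 := L.div_mem h1 hz
    rwa [map_mul, mul_div_cancel_right₀ _ h0] at h2
  have hP : ∀ f : P, algebraMap P (FractionRing P) f ∈ L := by
    intro f
    induction f using MvPolynomial.induction_on with
    | C k => exact hmem _ ((semigroupRing K (setB v)).algebraMap_mem k)
    | add f g hf hg => rw [map_add]; exact add_mem hf hg
    | mul_X f i hf => rw [map_mul]; exact mul_mem hf (hX i)
  rw [eq_top_iff]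
  intro x _
  obtain ⟨f, g, _, rfl⟩ := IsFractionRing.div_surjective (A := P) x
  exact L.div_mem (hP f) (hP g)

theorem normalization_semigroupRing_eq :
    normalization (semigroupRing K (setB v)) =
      (ehrhartRing K (polytopeQ v)).toSubring.map
        (algebraMap (MvPolynomial (Fin (s + 1)) K)
          (FractionRing (MvPolynomial (Fin (s + 1)) K))) := by
  set P := MvPolynomial (Fin (s + 1)) K
  ext x
  rw [normalization, subfieldClosure_semigroupRing_eq_top]
  have hinj := FaithfulSMul.algebraMap_injective P (FractionRing P)
  constructor
  · rintro ⟨-, hx⟩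
    have hx' : IsIntegral (semigroupRing K (setB v)) x := hx
    -- `S[z]` is factorial, hence integrally closed
    obtain ⟨f, rfl⟩ := IsIntegrallyClosed.isIntegral_iff.1 (hx'.tower_top (A := P))
    exact ⟨f, mem_ehrhartRing_of_isIntegral ((isIntegral_algebraMap_iff hinj).1 hx'), rfl⟩
  · rintro ⟨f, hf, rfl⟩
    exact ⟨trivial, (isIntegral_algebraMap_iff hinj).2 (isIntegral_of_mem_ehrhartRing hf)⟩

end Rings

/-! ### Integer rounding -/

section Rounding

variable {s q : ℕ} {v : Fin q → (Fin s →₀ ℕ)}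

theorem incidenceMatrix_mulVec_real (y : Fin q → ℝ) (i : Fin s) :
    ((incidenceMatrix v).map (fun n : ℕ => (n : ℝ))).mulVec y i = ∑ j, y j * v j i := by
  simp [Matrix.mulVec, dotProduct, incidenceMatrix, mul_comm]

theorem incidenceMatrix_mulVec_nat (y : Fin q → ℕ) (i : Fin s) :
    (incidenceMatrix v).mulVec y i = ∑ j, y j * v j i := by
  simp [Matrix.mulVec, dotProduct, incidenceMatrix, mul_comm]

/-- A feasible covering program attains its minimum: the feasible vectors of total at most that
of a given one form a compact set. -/
theorem exists_isLeast_covering (v : Fin q → (Fin s →₀ ℕ)) (x : Fin s → ℝ) {y₀ : Fin q → ℝ}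
    (hy₀ : 0 ≤ y₀) (hx₀ : ∀ i, x i ≤ ∑ j, y₀ j * v j i) :
    ∃ r, IsLeast {c : ℝ | ∃ y : Fin q → ℝ, 0 ≤ y ∧
      x ≤ ((incidenceMatrix v).map (fun n : ℕ => (n : ℝ))).mulVec y ∧ c = ∑ j, y j} r := by
  let C : Set (Fin q → ℝ) := {y | 0 ≤ y ∧ (∀ i, x i ≤ ∑ j, y j * v j i) ∧ ∑ j, y j ≤ ∑ j, y₀ j}
  have hC : C = {y | 0 ≤ y} ∩ ((⋂ i, {y : Fin q → ℝ | x i ≤ ∑ j, y j * v j i}) ∩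
      {y | ∑ j, y j ≤ ∑ j, y₀ j}) := by
    ext y
    simp [C]
  have hclosed : IsClosed C := by
    rw [hC]
    refine (isClosed_le continuous_const continuous_id).inter (IsClosed.inter ?_ ?_)
    · exact isClosed_iInter fun i => isClosed_le continuous_const (by fun_prop)
    · exact isClosed_le (by fun_prop) continuous_const
  have hcompact : IsCompact C := by
    refine (isCompact_Icc (a := (0 : Fin q → ℝ)) (b := fun _ => ∑ j, y₀ j)).of_isClosed_subset
      hclosed fun y hy => ⟨hy.1, fun j => ?_⟩
    exact (Finset.single_le_sum (fun j _ => hy.1 j) (Finset.mem_univ j)).trans hy.2.2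
  obtain ⟨y, hy, hmin⟩ := hcompact.exists_isMinOn ⟨y₀, hy₀, hx₀, le_rfl⟩
    (f := fun y => ∑ j, y j) (by fun_prop)
  refine ⟨∑ j, y j, ⟨y, hy.1, fun i => ?_, rfl⟩, ?_⟩
  · rw [incidenceMatrix_mulVec_real]
    exact hy.2.1 i
  · rintro _ ⟨w, hw, hwx, rfl⟩
    rcases le_total (∑ j, w j) (∑ j, y₀ j) with h | h
    · refine hmin ⟨hw, fun i => ?_, h⟩
      rw [← incidenceMatrix_mulVec_real]
      exact hwx i
    · exact hy.2.2.trans h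

/-- If every variable dividing `t^a` divides some `t^{v_j}`, then in a factorization of `t^a z^b`
into generators of `K[ℕB]` every factor other than a `t^{v_j} z` can be replaced by such a factor
or dropped, at the price of replacing `t^a` by a multiple. -/
theorem exists_cover_of_mem_closure {c : Fin (s + 1) →₀ ℕ}
    (hc : c ∈ AddSubmonoid.closure (setB v))
    (hpos : ∀ i : Fin s, c i.castSucc ≠ 0 → ∃ j, v j i ≠ 0) :
    ∃ y : Fin q → ℕ, (∀ i : Fin s, c i.castSucc ≤ ∑ j, y j * v j i) ∧
      ∑ j, y j ≤ c (Fin.last s) := by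
  induction hc using AddSubmonoid.closure_induction with
  | mem c hc =>
    rcases hc with (hc | ⟨i, rfl⟩) | ⟨j, rfl⟩
    · rw [Set.mem_singleton_iff] at hc
      subst hc
      exact ⟨0, by simp, by simp⟩
    · obtain ⟨j, hj⟩ := hpos i (by simp)
      refine ⟨Pi.single j 1, fun k => ?_, by simp⟩
      simp only [withZ_castSucc, Finsupp.single_apply, Pi.single_apply, ite_mul, one_mul, zero_mul,
        Finset.sum_ite_eq', Finset.mem_univ, if_true]
      split_ifs with h
      · subst h
        omega
      · exact Nat.zero_le _
    · exact ⟨Pi.single j 1, fun k => by simp [Pi.single_apply], by simp⟩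
  | zero => exact ⟨0, by simp, by simp⟩
  | add c c' _ _ ih ih' =>
    obtain ⟨y, hy, hle⟩ := ih fun i hi => hpos i (by simp [hi])
    obtain ⟨y', hy', hle'⟩ := ih' fun i hi => hpos i (by simp [hi])
    refine ⟨y + y', fun i => ?_, ?_⟩
    · simp only [Finsupp.add_apply, Pi.add_apply, add_mul, Finset.sum_add_distrib]
      exact add_le_add (hy i) (hy' i)
    · simp only [Finsupp.add_apply, Pi.add_apply, Finset.sum_add_distrib]
      exact add_le_add hle hle'

theorem hasIntegerRoundingLE_of_closure_eq (hdeg : ∀ j, (v j).degree = 2)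
    (h : AddSubmonoid.closure (setB v) = ehrhartSemigroup v) :
    HasIntegerRoundingLE (incidenceMatrix v) := by
  rintro α r ⟨⟨y, hy, hαy, rfl⟩, hmin⟩
  have hlower : ∀ w : Fin q → ℕ, α ≤ (fun i => (((incidenceMatrix v).mulVec w i : ℕ) : ℤ)) →
      ⌈∑ j, y j⌉ ≤ ∑ j, (w j : ℤ) := by
    intro w hw
    rw [Int.ceil_le]
    refine hmin ⟨fun j => w j, fun j => Nat.cast_nonneg _, fun i => ?_, by simp⟩
    have : α i ≤ (((incidenceMatrix v).mulVec w i : ℕ) : ℤ) := hw i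
    rw [incidenceMatrix_mulVec_nat] at this
    change (α i : ℝ) ≤ _
    rw [incidenceMatrix_mulVec_real]
    exact_mod_cast this
  refine ⟨?_, fun c hc => ?_⟩
  · have hsum : 0 ≤ ∑ j, y j := Finset.sum_nonneg fun j _ => hy j
    obtain ⟨b, hb⟩ := Int.eq_ofNat_of_zero_le (Int.ceil_nonneg hsum)
    -- the program for `α` is the program for the positive part of `α`
    let a : Fin s →₀ ℕ := Finsupp.equivFunOnFinite.symm fun i => (α i).toNat
    have hαa : ∀ i, α i ≤ a i := fun i => Int.self_le_toNat _
    have hay : ∀ i, (a i : ℝ) ≤ ∑ j, y j * v j i := by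
      intro i
      have h1 := hαy i
      rw [incidenceMatrix_mulVec_real] at h1
      have h2 : (0 : ℝ) ≤ ∑ j, y j * v j i :=
        Finset.sum_nonneg fun j _ => mul_nonneg (hy j) (Nat.cast_nonneg _)
      have h3 : ((a i : ℤ) : ℝ) = max (α i : ℝ) 0 := by
        simp only [a, Finsupp.equivFunOnFinite_symm_apply_apply, Int.toNat_eq_max]
        push_cast
        rfl
      rw [← Int.cast_natCast, h3]
      exact max_le h1 h2
    have hmem : withZ a b ∈ AddSubmonoid.closure (setB v) := by
      rw [h, withZ_mem_ehrhartSemigroup]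
      refine (fracDecomp_of_le hdeg hy (fun i => Nat.cast_nonneg _) hay).mono ?_
      have := Int.le_ceil (∑ j, y j)
      rw [hb] at this
      exact_mod_cast this
    obtain ⟨w, hw, hwb⟩ := exists_cover_of_mem_closure hmem fun i hi => by
      by_contra! h0
      have := hay i
      simp only [h0, Nat.cast_zero, mul_zero, Finset.sum_const_zero] at this
      rw [withZ_castSucc] at hi
      exact hi (by exact_mod_cast le_antisymm this (Nat.cast_nonneg _))
    have hαw : α ≤ (fun i => (((incidenceMatrix v).mulVec w i : ℕ) : ℤ)) := by
      intro i
      have h1 := hw i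
      rw [withZ_castSucc] at h1
      simp only [incidenceMatrix_mulVec_nat]
      exact (hαa i).trans (by exact_mod_cast h1)
    refine ⟨w, hαw, le_antisymm (hlower w hαw) ?_⟩
    rw [withZ_last] at hwb
    rw [hb]
    exact_mod_cast hwb
  · obtain ⟨w, hw, rfl⟩ := hc
    exact hlower w hw

theorem closure_eq_of_hasIntegerRoundingLE (hdeg : ∀ j, (v j).degree = 2)
    (h : HasIntegerRoundingLE (incidenceMatrix v)) :
    AddSubmonoid.closure (setB v) = ehrhartSemigroup v := by
  classical
  refine le_antisymm closure_setB_le_ehrhartSemigroup fun c hc => ?_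
  obtain ⟨a, b, rfl⟩ := exists_eq_withZ c
  obtain ⟨l, y, hl, hy, hx, hle⟩ := withZ_mem_ehrhartSemigroup.1 hc
  replace hx : ∀ i, (a i : ℝ) = l i + ∑ j, y j * v j i := hx
  -- a variable that divides no `t^{v_j}` occurs in `t^a` through the `e_i` only, so that its
  -- coefficient `l_i` is the integer `a_i`
  let iso : Fin s → Prop := fun i => ∀ j, v j i = 0
  have hiso : ∀ i, iso i → (a i : ℝ) = l i := by
    intro i hi
    have hi' : ∀ j, v j i = 0 := hi
    simp [hx i, hi']
  choose p hp using fun i (hi : ¬ iso i) => not_forall.1 hi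
  let a₀ : Fin s →₀ ℕ := Finsupp.equivFunOnFinite.symm fun i => if iso i then a i else 0
  let a₁ : Fin s →₀ ℕ := Finsupp.equivFunOnFinite.symm fun i => if iso i then 0 else a i
  have ha : a = a₀ + a₁ := by
    ext i
    simp only [a₀, a₁, Finsupp.add_apply, Finsupp.equivFunOnFinite_symm_apply_apply]
    split_ifs <;> simp
  -- each remaining `e_i` is at most a column `v_{p(i)}`, which takes over its coefficient
  let y₁ : Fin q → ℝ := fun j => y j + ∑ i, if hi : iso i then 0 else if p i hi = j then l i else 0
  have hterm : ∀ i j, 0 ≤ (if hi : iso i then 0 else if p i hi = j then l i else 0 : ℝ) := by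
    intro i j
    split_ifs
    exacts [le_rfl, hl i, le_rfl]
  have hy₁ : 0 ≤ y₁ := fun j => add_nonneg (hy j) (Finset.sum_nonneg fun i _ => hterm i j)
  have hy₁sum : ∑ j, y₁ j = ∑ j, y j + ∑ i, if iso i then 0 else l i := by
    simp only [y₁, Finset.sum_add_distrib]
    rw [Finset.sum_comm]
    congr 1
    refine Finset.sum_congr rfl fun i _ => ?_
    split_ifs with hi <;> simp
  have hcover : ∀ i, (((a₁ i : ℕ) : ℤ) : ℝ) ≤ ∑ j, y₁ j * v j i := by
    intro i
    by_cases hi : iso i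
    · simp only [a₁, Finsupp.equivFunOnFinite_symm_apply_apply, if_pos hi, Nat.cast_zero,
        Int.cast_zero]
      exact Finset.sum_nonneg fun j _ => mul_nonneg (hy₁ j) (Nat.cast_nonneg _)
    · simp only [a₁, Finsupp.equivFunOnFinite_symm_apply_apply, if_neg hi, Int.cast_natCast]
      rw [hx i]
      simp only [y₁, add_mul, Finset.sum_add_distrib]
      rw [add_comm]
      refine add_le_add_right ?_ _
      have h1 : l i ≤ ∑ k, if hk : iso k then 0 else if p k hk = p i hi then l k else 0 := by
        refine le_trans (by simp [hi]) (Finset.single_le_sum (fun k _ => hterm k (p i hi))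
          (Finset.mem_univ i))
      have h2 : (1 : ℝ) ≤ v (p i hi) i := by
        exact_mod_cast Nat.one_le_iff_ne_zero.2 (hp i hi)
      refine (h1.trans (le_mul_of_one_le_right
        (Finset.sum_nonneg fun k _ => hterm k (p i hi)) h2)).trans ?_
      exact Finset.single_le_sum (f := fun j =>
        (∑ k, if hk : iso k then 0 else if p k hk = j then l k else 0) * (v j i : ℝ))
        (fun j _ => mul_nonneg (Finset.sum_nonneg fun k _ => hterm k j) (Nat.cast_nonneg _))
        (Finset.mem_univ (p i hi))
  obtain ⟨r, hr⟩ := exists_isLeast_covering v (fun i => (((a₁ i : ℕ) : ℤ) : ℝ)) hy₁ hcover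
  obtain ⟨⟨w, hw, hwr⟩, -⟩ := h (fun i => (a₁ i : ℤ)) r hr
  have hdegree : ((∑ i, a₀ i : ℕ) : ℝ) = ∑ i, if iso i then l i else 0 := by
    rw [Nat.cast_sum]
    refine Finset.sum_congr rfl fun i _ => ?_
    simp only [a₀, Finsupp.equivFunOnFinite_symm_apply_apply]
    split_ifs with hi
    · exact hiso i hi
    · simp
  have hsplit : ∑ i, l i = (∑ i, if iso i then l i else 0) + ∑ i, if iso i then 0 else l i := by
    rw [← Finset.sum_add_distrib]
    refine Finset.sum_congr rfl fun i _ => ?_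
    split_ifs <;> simp
  have hrle : r ≤ ((b : ℤ) - (∑ i, a₀ i : ℕ) : ℤ) := by
    have h1 : r ≤ ∑ j, y₁ j := hr.2 ⟨y₁, hy₁, fun i => by
      rw [incidenceMatrix_mulVec_real]
      exact hcover i, rfl⟩
    rw [Int.cast_sub, Int.cast_natCast, Int.cast_natCast, hdegree]
    linarith
  have hwb : ∑ i, a₀ i + ∑ j, w j ≤ b := by
    have h1 := Int.ceil_le.2 hrle
    rw [hwr] at h1
    have h2 : ((∑ j, w j : ℕ) : ℤ) ≤ b - (∑ i, a₀ i : ℕ) := by exact_mod_cast h1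
    omega
  have h0 : withZ a₀ (∑ i, a₀ i) ∈ AddSubmonoid.closure (setB v) :=
    withZ_mem_closure_of_decomp (m := a₀) (y := 0) (by simp) (by simp)
  have h1 : withZ a₁ (∑ j, w j) ∈ AddSubmonoid.closure (setB v) := by
    refine withZ_mem_closure_of_le hdeg (a := ∑ j, w j • v j)
      (withZ_sum_nsmul_mem_closure Finset.univ w v fun j => Or.inr ⟨j, rfl⟩) fun i => ?_
    have h2 := hw i
    simp only [incidenceMatrix_mulVec_nat] at h2
    have h3 : a₁ i ≤ ∑ j, w j * v j i := by exact_mod_cast h2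
    simpa using h3
  have h2 := add_mem (add_mem h0 h1)
    (withZ_zero_mem_closure (v := v) (b - (∑ i, a₀ i + ∑ j, w j)))
  rwa [← withZ_add, ← withZ_add, add_zero, Nat.add_sub_cancel' hwb, ← ha] at h2

theorem degree_eq_two_of_mem_minGenExponents {K : Type*} [Field K]
    {I : Ideal (MvPolynomial (Fin s) K)} (hI : IsGeneratedByQuadraticMonomials I)
    {a : Fin s →₀ ℕ} (ha : a ∈ minGenExponents I) : a.degree = 2 := by
  classical
  obtain ⟨F, hF, rfl⟩ := hI
  obtain ⟨c, hc, hca⟩ := MvPolynomial.mem_ideal_span_monomial_image.1 ha.1 a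
    (by simp [MvPolynomial.mem_support_iff])
  rw [le_antisymm (ha.2 (Ideal.subset_span ⟨c, hc, rfl⟩) hca) hca]
  exact hF c hc

end Rounding

theorem mainTheorem2 {K : Type*} [Field K] {s q : ℕ} (I : Ideal (MvPolynomial (Fin s) K))
    (hI : IsGeneratedByQuadraticMonomials I)
    (v : Fin q → (Fin s →₀ ℕ)) (hv : Function.Injective v)
    (hrange : Set.range v = minGenExponents I) :
    normalization (semigroupRing K (setB v)) =
        (ehrhartRing K (polytopeQ v)).toSubring.map
          (algebraMap (MvPolynomial (Fin (s + 1)) K)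
            (FractionRing (MvPolynomial (Fin (s + 1)) K))) ∧
      (semigroupRing K (setB v) = ehrhartRing K (polytopeQ v) ↔
        HasIntegerRoundingLE (incidenceMatrix v)) := by
  have hdeg : ∀ j, (v j).degree = 2 := fun j =>
    degree_eq_two_of_mem_minGenExponents hI (hrange ▸ Set.mem_range_self j)
  refine ⟨normalization_semigroupRing_eq, ?_⟩
  rw [semigroupRing, ehrhartRing_eq, monomialSubring_inj]
  exact ⟨hasIntegerRoundingLE_of_closure_eq hdeg, closure_eq_of_hasIntegerRoundingLE hdeg⟩
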